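/- Let $\mathbb D$ be the open unit disk in $\mathbb C$, and let $\mathcal A$ be a complex unital Banach algebra with $\|1_{\mathcal A}\|=1$ and group of invertible elements $\mathcal A_*$. Let $\{F_t\}_{t\ge 0}$ be a continuous semigroup of holomorphic self-maps of $\mathbb D$ (that is, $(t,z)\mapsto F_t(z)$ is continuous on $[0,\infty)\times\mathbb D$, $F_{t+s}=F_t\circ F_s$ and $F_0=\mathrm{id}$), generated by the holomorphic function $f:\mathbb D\to\mathbb C$, $f(z)=\lim_{t\to0^+}\frac{F_t(z)-z}{t}$. Suppose that $f(z_0)=0$ for some $z_0\in\mathbb D$ and that $\lambda:=-f'(z_0)$ satisfies $\operatorname{Re}\lambda>0$. Let $\{\Gamma_t\}_{t\ge0}$ be a holomorphic semicocycle over $\{F_t\}$, i.e. each $\Gamma_t:\mathbb D\to\mathcal A$ is holomorphic, $(t,z)\mapsto\Gamma_t(z)$ is continuous on $[0,\infty)\times\mathbb D$, $\Gamma_t(F_s(z))\Gamma_s(z)=\Gamma_{t+s}(z)$ and $\Gamma_0(z)=1_{\mathcal A}$ for all $t,s\ge0$, $z\in\mathbb D$. Then the one-sided derivative $B_0:=\frac{d}{dt}\Gamma_t(z_0)\big|_{t=0}$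 exists. Let $\operatorname{ad}_{B_0}:\mathcal A\to\mathcal A$ be the bounded operator $\operatorname{ad}_{B_0}(a)=aB_0-B_0a$. If $$\sigma(\operatorname{ad}_{B_0})\cap\{k\lambda: k=1,2,3,\dots\}=\emptyset,$$ then there is a holomorphic $M:\mathbb D\to\mathcal A$ with values in $\mathcal A_*$ such that $$\Gamma_t(z)=M(F_t(z))^{-1}e^{tB_0}M(z)\qquad\text{for all } t\ge0,\ z\in\mathbb D.$$ -/

import Mathlib

/-- A one-parameter continuous semigroup of holomorphic self-maps of the open unit disk.
Only the values `F t z` with `0 ≤ t` and `z` in the disk matter. -/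
structure IsHolSemigroup (F : ℝ → ℂ → ℂ) : Prop where
  mapsTo : ∀ t : ℝ, 0 ≤ t → Set.MapsTo (F t) (Metric.ball (0 : ℂ) 1) (Metric.ball (0 : ℂ) 1)
  holomorphic : ∀ t : ℝ, 0 ≤ t → DifferentiableOn ℂ (F t) (Metric.ball (0 : ℂ) 1)
  continuousOn : ContinuousOn (fun p : ℝ × ℂ => F p.1 p.2)
    (Set.Ici (0 : ℝ) ×ˢ Metric.ball (0 : ℂ) 1)
  add : ∀ t s : ℝ, 0 ≤ t → 0 ≤ s → ∀ z ∈ Metric.ball (0 : ℂ) 1, F (t + s) z = F t (F s z)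
  zero : ∀ z ∈ Metric.ball (0 : ℂ) 1, F 0 z = z

/-- `f` is the (holomorphic) infinitesimal generator of the family `F` on the unit disk:
`f z` is the limit of `(F t z - z) / t` as `t → 0⁺`. -/
structure IsHolGenerator (F : ℝ → ℂ → ℂ) (f : ℂ → ℂ) : Prop where
  holomorphic : DifferentiableOn ℂ f (Metric.ball (0 : ℂ) 1)
  tendsto : ∀ z ∈ Metric.ball (0 : ℂ) 1,
    Filter.Tendsto (fun t : ℝ => (F t z - z) / (t : ℂ)) (nhdsWithin 0 (Set.Ioi 0)) (nhds (f z))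

/-- A holomorphic semicocycle over `F` with values in the Banach algebra `A`. -/
structure IsHolSemicocycle {A : Type*} [NormedRing A] [NormedAlgebra ℂ A]
    (F : ℝ → ℂ → ℂ) (Γ : ℝ → ℂ → A) : Prop where
  holomorphic : ∀ t : ℝ, 0 ≤ t → DifferentiableOn ℂ (Γ t) (Metric.ball (0 : ℂ) 1)
  continuousOn : ContinuousOn (fun p : ℝ × ℂ => Γ p.1 p.2)
    (Set.Ici (0 : ℝ) ×ˢ Metric.ball (0 : ℂ) 1)
  chain : ∀ t s : ℝ, 0 ≤ t → 0 ≤ s → ∀ z ∈ Metric.ball (0 : ℂ) 1,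
    Γ t (F s z) * Γ s z = Γ (t + s) z
  zero : ∀ z ∈ Metric.ball (0 : ℂ) 1, Γ 0 z = 1

/-- The generator of a semicocycle: the one-sided derivative of `t ↦ Γ t z` at `t = 0`. -/
noncomputable def semicocycleGenerator {A : Type*} [NormedRing A] [NormedAlgebra ℂ A]
    (Γ : ℝ → ℂ → A) (z : ℂ) : A :=
  derivWithin (fun t : ℝ => Γ t z) (Set.Ici 0) 0

/-- The bounded operator `a ↦ a * b - b * a` on `A`. -/
noncomputable def adOp {A : Type*} [NormedRing A] [NormedAlgebra ℂ A] (b : A) : A →L[ℂ] A :=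
  (ContinuousLinearMap.mul ℂ A).flip b - ContinuousLinearMap.mul ℂ A b

theorem adOp_apply {A : Type*} [NormedRing A] [NormedAlgebra ℂ A] (b a : A) :
    adOp b a = a * b - b * a := by
  simp [adOp]

/-- `M` is a holomorphic map from the disk to the invertible elements of `A` with
`Γ t z = (M (F t z))⁻¹ * exp (t b) * M z`. -/
structure IsLinearization {A : Type*} [NormedRing A] [NormedAlgebra ℂ A]
    (F : ℝ → ℂ → ℂ) (Γ : ℝ → ℂ → A) (b : A) (M : ℂ → A) : Prop where
  holomorphic : DifferentiableOn ℂ M (Metric.ball (0 : ℂ) 1)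
  isUnit : ∀ z ∈ Metric.ball (0 : ℂ) 1, IsUnit (M z)
  eq : ∀ t : ℝ, 0 ≤ t → ∀ z ∈ Metric.ball (0 : ℂ) 1,
    Γ t z = Ring.inverse (M (F t z)) * NormedSpace.exp ((t : ℂ) • b) * M z

/-! A linearization is a common fixed point `M`, with invertible values, of the commuting operators
T_s h = e^{-sB} (h ∘ F_s) Γ_s (`transfer`). On a monomial (z - z₀)^k X, T_τ - 1 acts to leading
order as X ↦ e^{-λkτ} e^{-τB} X e^{τB} - X (`homologicalOp`), whose τ-derivative at 0 is ad_B - λk.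
Since λk is not in the spectrum, this map is invertible for small τ ≠ 0. Hence T_τ P - P can be made
to vanish to any prescribed order, with P(z₀) = 1, by correcting P one monomial at a time
(`exists_approx`).

Because Re λ > 0, F_1 contracts near z₀, and by the Schwarz lemma every orbit in the disk reaches
any neighbourhood of z₀. On functions vanishing to a high enough order n the contraction q^n beats
the growth of e^{-B} and Γ_1, so the iterates T_1^j P converge near z₀, and the limit spreads over
the disk along orbits (`exists_fixed_of_approx`).

The limit M is fixed by T_1 only. For other s, T_s M - M is again fixed by T_1; absence of
resonances forces it to vanish to high order, and then it is zero (`eq_zero_of_fixed`).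
Invertibility holds near z₀, where M is close to 1, and is carried back along orbits by the
invertible Γ_t. -/

open Filter Topology Set Asymptotics

/-! ### Norm continuous semigroups in a Banach algebra. -/

section NormContinuousSemigroups

variable {A : Type*} [NormedRing A] [NormedAlgebra ℂ A] [CompleteSpace A]

theorem exp_add_smul (a b : ℂ) (B : A) :
    NormedSpace.exp ((a + b) • B) = NormedSpace.exp (a • B) * NormedSpace.exp (b • B) := by
  let _ : NormedAlgebra ℚ A := NormedAlgebra.restrictScalars ℚ ℂ A
  rw [add_smul, NormedSpace.exp_add_of_commute]
  exact ((Commute.refl B).smul_left a).smul_right b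

theorem exp_smul_mul_exp_neg_smul (a : ℂ) (B : A) :
    NormedSpace.exp (a • B) * NormedSpace.exp ((-a) • B) = 1 := by
  rw [← exp_add_smul]; simp

theorem exp_neg_smul_mul_exp_smul (a : ℂ) (B : A) :
    NormedSpace.exp ((-a) • B) * NormedSpace.exp (a • B) = 1 := by
  rw [← exp_add_smul]; simp

theorem isUnit_exp_smul (a : ℂ) (B : A) : IsUnit (NormedSpace.exp (a • B)) :=
  ⟨⟨_, _, exp_smul_mul_exp_neg_smul a B, exp_neg_smul_mul_exp_smul a B⟩, rfl⟩

theorem hasDerivAt_exp_ofReal_smul (c : ℂ) (B : A) (t : ℝ) :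
    HasDerivAt (fun u : ℝ => NormedSpace.exp ((c * (u : ℂ)) • B))
      (NormedSpace.exp ((c * (t : ℂ)) • B) * (c • B)) t := by
  have h := hasDerivAt_exp_smul_const (𝕂 := ℝ) (c • B) t
  have e : ∀ u : ℝ, u • c • B = (c * (u : ℂ)) • B := fun u => by
    rw [← Complex.coe_smul, smul_smul, mul_comm]
  simpa only [e] using h

/-- A norm continuous one-parameter semigroup is differentiable at the origin. -/
theorem exists_hasDerivWithinAt_of_semigroup {S : ℝ → A} (hc : ContinuousOn S (Ici 0))
    (h0 : S 0 = 1) (hadd : ∀ s t, 0 ≤ s → 0 ≤ t → S (s + t) = S s * S t) :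
    ∃ B, HasDerivWithinAt S B (Ici 0) 0 := by
  -- Freezing `S` at negative times gives a function continuous on the whole line, so its primitive
  -- `V` has two-sided derivatives, including at 0.
  set S' : ℝ → A := fun t => S (max t 0) with hS'
  have hS'c : Continuous S' := by
    refine hc.comp_continuous (by fun_prop) fun t => ?_
    simp
  set V : ℝ → A := fun u => ∫ x in (0 : ℝ)..u, S' x with hV
  have hVd : ∀ u, HasDerivAt V (S' u) u := fun u =>
    intervalIntegral.integral_hasDerivAt_right (hS'c.intervalIntegrable _ _)
      hS'c.stronglyMeasurable.stronglyMeasurableAtFilter hS'c.continuousAt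
  have hV0 : V 0 = 0 := by simp [hV]
  obtain ⟨a, ha, hu⟩ : ∃ a > 0, IsUnit (V a) := by
    have h1 : Tendsto (slope V 0) (𝓝[>] 0) (𝓝 1) := by
      have h := hasDerivAt_iff_tendsto_slope.1 (hVd 0)
      have hone : S' 0 = 1 := by simp [hS', h0]
      rw [hone] at h
      exact h.mono_left (nhdsWithin_mono _ fun x hx => ne_of_gt hx)
    have h2 : ∀ᶠ u in 𝓝[>] (0 : ℝ), IsUnit (slope V 0 u) :=
      h1.eventually (Units.isOpen.mem_nhds isUnit_one)
    obtain ⟨a, ha, ha0⟩ := (h2.and self_mem_nhdsWithin).exists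
    have ha0 : 0 < a := ha0
    refine ⟨a, ha0, ?_⟩
    have : V a = algebraMap ℂ A (a : ℂ) * slope V 0 a := by
      rw [slope_def_module, hV0, ← Algebra.smul_def, sub_zero, sub_zero, Complex.coe_smul,
        smul_smul, mul_inv_cancel₀ ha0.ne', one_smul]
    rw [this]
    refine IsUnit.mul (IsUnit.map _ ?_) ha
    simpa using ha0.ne'
  -- Averaging trick: V(a) S(t) is the integral of `S` over [t, a + t], which is differentiable in
  -- t; dividing by the invertible V(a) passes this on to `S`.
  have key : ∀ t ∈ Ici (0 : ℝ), S t = Ring.inverse (V a) * (V (a + t) - V t) := by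
    intro t ht
    have ht : 0 ≤ t := ht
    have h1 : V a * S t = V (a + t) - V t := by
      have h2 : V a * S t = ∫ x in (0 : ℝ)..a, S' x * S t := by
        have := ((ContinuousLinearMap.mul ℝ A).flip (S t)).intervalIntegral_comp_comm
          (hS'c.intervalIntegrable (μ := MeasureTheory.volume) 0 a)
        simpa using this.symm
      have h3 : ∫ x in (0 : ℝ)..a, S' x * S t = ∫ x in (0 : ℝ)..a, S' (x + t) := by
        refine intervalIntegral.integral_congr fun x hx => ?_
        rw [uIcc_of_le ha.le] at hx
        simp only [hS']
        rw [max_eq_left hx.1, max_eq_left (add_nonneg hx.1 ht), hadd x t hx.1 ht]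
      rw [h2, h3, intervalIntegral.integral_comp_add_right, zero_add]
      exact (intervalIntegral.integral_interval_sub_left (hS'c.intervalIntegrable _ _)
        (hS'c.intervalIntegrable _ _)).symm
    rw [← h1, Ring.inverse_mul_cancel_left _ _ hu]
  refine ⟨Ring.inverse (V a) * (S' (a + 0) - S' 0), ?_⟩
  refine HasDerivWithinAt.congr ?_ key (key 0 self_mem_Ici)
  have h := (((hVd (a + 0)).comp_const_add a 0).sub (hVd 0)).const_mul (Ring.inverse (V a))
  exact h.hasDerivWithinAt

theorem hasDerivWithinAt_Ici_of_shift {E : Type*} [NormedAddCommGroup E] [NormedSpace ℝ E]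
    {u : ℝ → E} {v : E} {t : ℝ} (h : HasDerivWithinAt (fun s => u (s + t)) v (Ici 0) 0) :
    HasDerivWithinAt u v (Ici t) t := by
  have h1 : HasDerivWithinAt (fun s => u (s + t)) v (Ici 0) (t - t) := by simpa using h
  have h2 := HasDerivWithinAt.scomp (h := fun x => x - t) (h' := 1) (s := Ici t) t h1
    ((hasDerivWithinAt_id t _).sub_const t) (fun x hx => by simpa using hx)
  simpa [Function.comp_def] using h2

/-- A norm continuous one-parameter semigroup is the exponential of its generator. -/
theorem semigroup_eq_exp {S : ℝ → A} {B : A} (hc : ContinuousOn S (Ici 0))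
    (h0 : S 0 = 1) (hadd : ∀ s t, 0 ≤ s → 0 ≤ t → S (s + t) = S s * S t)
    (hB : HasDerivWithinAt S B (Ici 0) 0) {t : ℝ} (ht : 0 ≤ t) :
    S t = NormedSpace.exp ((t : ℂ) • B) := by
  have hS : ∀ x, 0 ≤ x → HasDerivWithinAt S (B * S x) (Ici x) x := by
    intro x hx
    refine hasDerivWithinAt_Ici_of_shift ?_
    refine (hB.mul_const (S x)).congr (fun s hs => hadd s x hs hx) ?_
    simp [h0]
  have hE : ∀ x : ℝ, HasDerivAt (fun u : ℝ => NormedSpace.exp ((-(u : ℂ)) • B))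
      (-(NormedSpace.exp ((-(x : ℂ)) • B) * B)) x := by
    intro x
    simpa using hasDerivAt_exp_ofReal_smul (-1) B x
  -- The product e^{-uB} S(u) has zero right derivative, so it keeps its initial value 1.
  have hconst := constant_of_has_deriv_right_zero
    (f := fun u : ℝ => NormedSpace.exp ((-(u : ℂ)) • B) * S u) (a := 0) (b := t)
    (ContinuousOn.mul (fun x _ => (hE x).continuousAt.continuousWithinAt)
      (hc.mono Icc_subset_Ici_self))
    (fun x hx => by
      refine ((hE x).hasDerivWithinAt.mul (hS x hx.1)).congr_deriv ?_
      simp [mul_assoc])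
    t ⟨ht, le_rfl⟩
  have h1 : NormedSpace.exp ((-(t : ℂ)) • B) * S t = 1 := by simpa [h0] using hconst
  calc S t = NormedSpace.exp ((t : ℂ) • B) * (NormedSpace.exp ((-(t : ℂ)) • B) * S t) := by
        rw [← mul_assoc, exp_smul_mul_exp_neg_smul, one_mul]
    _ = _ := by rw [h1, mul_one]

end NormContinuousSemigroups

/-! ### The flow near an interior zero of its generator. -/

section Flow

variable {F : ℝ → ℂ → ℂ} {f : ℂ → ℂ}

local notation "𝔻" => Metric.ball (0 : ℂ) 1

theorem IsHolSemigroup.continuousOn_orbit (hF : IsHolSemigroup F) {z : ℂ} (hz : z ∈ 𝔻) :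
    ContinuousOn (fun t => F t z) (Ici 0) :=
  hF.continuousOn.comp (f := fun t : ℝ => (t, z)) (by fun_prop) fun t ht => ⟨ht, hz⟩

theorem IsHolGenerator.hasDerivWithinAt (hF : IsHolSemigroup F) (hf : IsHolGenerator F f)
    {z : ℂ} (hz : z ∈ 𝔻) {t : ℝ} (ht : 0 ≤ t) :
    HasDerivWithinAt (fun s => F s z) (f (F t z)) (Ici t) t := by
  refine hasDerivWithinAt_Ici_of_shift ?_
  have hw := hF.mapsTo t ht hz
  have h1 : HasDerivWithinAt (fun s => F s (F t z)) (f (F t z)) (Ici 0) 0 := by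
    rw [hasDerivWithinAt_iff_tendsto_slope, Ici_sdiff_left]
    refine (hf.tendsto _ hw).congr' ?_
    filter_upwards [self_mem_nhdsWithin] with s hs
    rw [slope_def_module, hF.zero _ hw, sub_zero, div_eq_inv_mul, ← Complex.ofReal_inv,
      Complex.real_smul]
  exact h1.congr (fun s hs => hF.add s t hs ht z hz) (by rw [hF.add 0 t le_rfl ht z hz])

/-- Orbits that start close to a fixed point stay close to it for a bounded time. -/
theorem IsHolSemigroup.eventually_forall_mem (hF : IsHolSemigroup F) {z₀ : ℂ} (hz₀ : z₀ ∈ 𝔻)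
    (hfix : ∀ t, 0 ≤ t → F t z₀ = z₀) {U : Set ℂ} (hU : U ∈ 𝓝 z₀) (T : ℝ) :
    ∀ᶠ z in 𝓝 z₀, ∀ t ∈ Icc 0 T, F t z ∈ U := by
  have hD : 𝔻 ∈ 𝓝 z₀ := Metric.isOpen_ball.mem_nhds hz₀
  have h : ∀ᶠ z in 𝓝 z₀, ∀ t ∈ Icc 0 T, z ∈ 𝔻 → 0 ≤ t → F t z ∈ U := by
    refine isCompact_Icc.eventually_forall_of_forall_eventually fun t ht => ?_
    have hc := hF.continuousOn (t, z₀) ⟨ht.1, hz₀⟩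
    have h1 : ∀ᶠ p in 𝓝[Ici (0 : ℝ) ×ˢ 𝔻] (t, z₀), F p.1 p.2 ∈ U :=
      hc.eventually (by simpa [hfix t ht.1] using hU)
    rw [eventually_nhdsWithin_iff] at h1
    have h2 : Tendsto (fun q : ℂ × ℝ => (q.2, q.1)) (𝓝 (z₀, t)) (𝓝 (t, z₀)) :=
      (continuous_swap.tendsto (z₀, t))
    filter_upwards [h2.eventually h1] with q hq hq1 hq2
    exact hq ⟨hq2, hq1⟩
  filter_upwards [h, hD] with z hz hzD t ht
  exact hz t ht hzD ht.1

/-- Zeros of the generator are fixed points of the semigroup. -/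
theorem IsHolGenerator.apply_eq_self (hF : IsHolSemigroup F) (hf : IsHolGenerator F f)
    {z₀ : ℂ} (hz₀ : z₀ ∈ 𝔻) (hfz₀ : f z₀ = 0) {t : ℝ} (ht : 0 ≤ t) : F t z₀ = z₀ := by
  -- Compactness puts the orbit segment in a smaller closed disk, where `f` is Lipschitz; ODE
  -- uniqueness then identifies the orbit with the constant solution.
  have hcomp : IsCompact ((fun s => F s z₀) '' Icc 0 t ∪ {z₀}) :=
    (isCompact_Icc.image_of_continuousOn
      ((hF.continuousOn_orbit hz₀).mono Icc_subset_Ici_self)).union isCompact_singleton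
  obtain ⟨r, hr1, hr⟩ : ∃ r < 1, (fun s => F s z₀) '' Icc 0 t ∪ {z₀} ⊆ Metric.closedBall 0 r := by
    obtain ⟨w, hw, hmax⟩ := hcomp.exists_isMaxOn ⟨z₀, by simp⟩ continuous_norm.continuousOn
    refine ⟨‖w‖, ?_, fun x hx => by simpa using hmax hx⟩
    rcases hw with ⟨s, hs, rfl⟩ | rfl
    · simpa using hF.mapsTo s hs.1 hz₀
    · simpa using hz₀
  obtain ⟨K, hK⟩ : ∃ K, LipschitzOnWith K f (Metric.closedBall 0 r) := by
    have hsub : Metric.closedBall (0 : ℂ) r ⊆ 𝔻 := Metric.closedBall_subset_ball hr1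
    have hd : ∀ x ∈ Metric.closedBall (0 : ℂ) r, DifferentiableAt ℂ f x := fun x hx =>
      hf.holomorphic.differentiableAt (Metric.isOpen_ball.mem_nhds (hsub hx))
    obtain ⟨C, hC⟩ := (isCompact_closedBall (0 : ℂ) r).exists_bound_of_continuousOn
      (((hf.holomorphic.deriv Metric.isOpen_ball).continuousOn).mono hsub)
    exact ⟨C.toNNReal, (convex_closedBall _ _).lipschitzOnWith_of_nnnorm_deriv_le hd
      fun x hx => by
        rw [← NNReal.coe_le_coe]
        exact (hC x hx).trans (Real.le_coe_toNNReal C)⟩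
  have := ODE_solution_unique_of_mem_Icc_right (v := fun _ => f)
    (s := fun _ => Metric.closedBall 0 r) (f := fun s => F s z₀) (g := fun _ => z₀) (a := 0) (b := t)
    (fun _ _ => hK) ((hF.continuousOn_orbit hz₀).mono Icc_subset_Ici_self)
    (fun s hs => hf.hasDerivWithinAt hF hz₀ hs.1)
    (fun s hs => hr (Or.inl ⟨s, ⟨hs.1, hs.2.le⟩, rfl⟩)) continuousOn_const
    (fun s _ => by simpa [hfz₀] using hasDerivWithinAt_const s (Ici s) z₀)
    (fun s _ => hr (Or.inr rfl)) (hF.zero z₀ hz₀)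
  exact this ⟨ht, le_rfl⟩

/-- The multiplier of the semigroup at an interior fixed point. -/
theorem IsHolGenerator.hasDerivAt_flow (hF : IsHolSemigroup F) (hf : IsHolGenerator F f)
    {z₀ : ℂ} (hz₀ : z₀ ∈ 𝔻) (hfz₀ : f z₀ = 0) {t : ℝ} (ht : 0 ≤ t) :
    HasDerivAt (F t) (Complex.exp (deriv f z₀ * t)) z₀ := by
  have hD : 𝔻 ∈ 𝓝 z₀ := Metric.isOpen_ball.mem_nhds hz₀
  have hfix : ∀ s, 0 ≤ s → F s z₀ = z₀ := fun s hs => hf.apply_eq_self hF hz₀ hfz₀ hs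
  have hfd : HasDerivAt f (deriv f z₀) z₀ := (hf.holomorphic.differentiableAt hD).hasDerivAt
  set μ := deriv f z₀ with hμ
  obtain ⟨K, U, hU, hK⟩ : ∃ K, ∃ U ∈ 𝓝 z₀, LipschitzOnWith K f U := by
    have : ContDiffAt ℂ 1 f z₀ :=
      ((hf.holomorphic.analyticAt hD).contDiffAt)
    exact this.exists_lipschitzOnWith
  -- Grönwall comparison with the stationary trajectory.
  have hgrow : ∀ᶠ z in 𝓝 z₀, ∀ s ∈ Icc 0 t, ‖F s z - z₀‖ ≤ ‖z - z₀‖ * Real.exp (K * t) := by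
    filter_upwards [hF.eventually_forall_mem hz₀ hfix hU t, hD] with z hz hzD s hs
    have h := dist_le_of_trajectories_ODE_of_mem (v := fun _ => f) (s := fun _ => U)
      (f := fun s => F s z) (g := fun _ => z₀) (a := 0) (b := t) (δ := ‖z - z₀‖)
      (fun _ _ => hK) ((hF.continuousOn_orbit hzD).mono Icc_subset_Ici_self)
      (fun s hs => hf.hasDerivWithinAt hF hzD hs.1)
      (fun s hs => hz s ⟨hs.1, hs.2.le⟩) continuousOn_const
      (fun s _ => by simpa [hfz₀] using hasDerivWithinAt_const s (Ici s) z₀)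
      (fun s _ => mem_of_mem_nhds hU) (by rw [hF.zero z hzD, dist_eq_norm]) s hs
    rw [dist_eq_norm] at h
    refine h.trans ?_
    have : s - 0 ≤ t := by simpa using hs.2
    gcongr
  rw [hasDerivAt_iff_isLittleO, hfix t ht]
  rw [isLittleO_iff]
  intro ε hε
  -- Chosen so that the final estimate is exactly ε ‖z - z₀‖; `t + 1` instead of `t` avoids division
  -- by zero at t = 0.
  set c : ℝ := ε / (Real.exp (‖μ‖ * t) * Real.exp (‖μ‖ * t) * Real.exp (K * t) * (t + 1)) with hc
  have hcpos : 0 < c := by positivity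
  have hlin : {w : ℂ | ‖f w - μ * (w - z₀)‖ ≤ c * ‖w - z₀‖} ∈ 𝓝 z₀ := by
    have h := (hasDerivAt_iff_isLittleO.1 hfd).bound hcpos
    filter_upwards [h] with w hw
    simpa [hfz₀, mul_comm] using hw
  filter_upwards [hF.eventually_forall_mem hz₀ hfix hlin t, hgrow, hD] with z hz hg hzD
  have hexp : ∀ s : ℝ, HasDerivAt (fun s : ℝ => Complex.exp (-μ * s)) (Complex.exp (-μ * s) * (-μ)) s := by
    intro s
    have := (((hasDerivAt_id (s : ℂ)).const_mul (-μ)).cexp).comp_ofReal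
    simpa using this
  -- Variation of constants: the factor e^{-μs} cancels the linear part, leaving only the
  -- linearization error of `f`.
  have hv : ∀ s ∈ Ico 0 t, HasDerivWithinAt (fun s : ℝ => Complex.exp (-μ * s) * (F s z - z₀))
      (Complex.exp (-μ * s) * (f (F s z) - μ * (F s z - z₀))) (Ici s) s := by
    intro s hs
    refine ((hexp s).hasDerivWithinAt.mul
      ((hf.hasDerivWithinAt hF hzD hs.1).sub_const z₀)).congr_deriv ?_
    ring
  have hnexp : ∀ s ∈ Icc 0 t, ∀ a : ℂ, ‖a‖ ≤ ‖μ‖ → ‖Complex.exp (a * s)‖ ≤ Real.exp (‖μ‖ * t) := by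
    intro s hs a ha
    refine (Complex.norm_exp_le_exp_norm _).trans ?_
    rw [norm_mul, Complex.norm_real, Real.norm_of_nonneg hs.1]
    exact Real.exp_le_exp.2 (mul_le_mul ha hs.2 hs.1 (norm_nonneg _))
  have hmain := norm_image_sub_le_of_norm_deriv_right_le_segment
    (f := fun s : ℝ => Complex.exp (-μ * s) * (F s z - z₀))
    (C := Real.exp (‖μ‖ * t) * (c * (‖z - z₀‖ * Real.exp (K * t))))
    (ContinuousOn.mul (fun s _ => (hexp s).continuousAt.continuousWithinAt)
      (((hF.continuousOn_orbit hzD).mono Icc_subset_Ici_self).sub continuousOn_const)) hv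
    (fun s hs => by
      have hs' : s ∈ Icc 0 t := ⟨hs.1, hs.2.le⟩
      rw [norm_mul]
      refine mul_le_mul (hnexp s hs' _ (by simp)) ?_ (norm_nonneg _) (Real.exp_pos _).le
      exact (hz s hs').trans (mul_le_mul_of_nonneg_left (hg s hs') hcpos.le)) t ⟨ht, le_rfl⟩
  simp only [Complex.ofReal_zero, mul_zero, Complex.exp_zero, one_mul, hF.zero z hzD] at hmain
  have hid : F t z - z₀ - (z - z₀) • Complex.exp (μ * t) =
      Complex.exp (μ * t) * (Complex.exp (-μ * t) * (F t z - z₀) - (z - z₀)) := by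
    rw [mul_sub, ← mul_assoc, ← Complex.exp_add]
    simp [mul_comm]
  rw [hid, norm_mul]
  calc _ ≤ Real.exp (‖μ‖ * t) *
        (Real.exp (‖μ‖ * t) * (c * (‖z - z₀‖ * Real.exp (K * t))) * (t - 0)) :=
        mul_le_mul (hnexp t ⟨ht, le_rfl⟩ _ le_rfl) hmain (norm_nonneg _) (Real.exp_pos _).le
    _ ≤ Real.exp (‖μ‖ * t) *
        (Real.exp (‖μ‖ * t) * (c * (‖z - z₀‖ * Real.exp (K * t))) * (t + 1)) := by
        gcongr; linarith
    _ = ε * ‖z - z₀‖ := by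
        rw [hc]; field_simp

end Flow

/-! ### Attraction to the fixed point, and invertibility of semicocycles. -/

section DiscDynamics

local notation "𝔻" => Metric.ball (0 : ℂ) 1

/-- The involutive automorphism of the unit disc exchanging `a` and `0`. -/
noncomputable def discInvolution (a w : ℂ) : ℂ := (a - w) / (1 - (starRingEnd ℂ) a * w)

theorem one_sub_conj_mul_ne_zero {a w : ℂ} (ha : a ∈ 𝔻) (hw : w ∈ 𝔻) :
    1 - (starRingEnd ℂ) a * w ≠ 0 := by
  intro h
  have h1 : ‖(starRingEnd ℂ) a * w‖ = 1 := by
    rw [← sub_eq_zero.1 h, norm_one]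
  rw [norm_mul, RCLike.norm_conj] at h1
  rw [mem_ball_zero_iff] at ha hw
  nlinarith [norm_nonneg a, norm_nonneg w]

/-- The identity |1 - āw|² - |a - w|² = (1 - |a|²)(1 - |w|²) makes the quotient have modulus below
one. -/
theorem discInvolution_mapsTo {a : ℂ} (ha : a ∈ 𝔻) : MapsTo (discInvolution a) 𝔻 𝔻 := by
  intro w hw
  have hne := one_sub_conj_mul_ne_zero ha hw
  rw [mem_ball_zero_iff] at ha hw ⊢
  rw [discInvolution, norm_div, div_lt_one (norm_pos_iff.2 hne)]
  refine lt_of_pow_lt_pow_left₀ 2 (norm_nonneg _) ?_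
  have ha2 : ‖a‖ ^ 2 < 1 := by nlinarith [norm_nonneg a]
  have hw2 : ‖w‖ ^ 2 < 1 := by nlinarith [norm_nonneg w]
  rw [Complex.sq_norm, Complex.normSq_apply] at *
  rw [Complex.sq_norm, Complex.normSq_apply] at *
  simp only [Complex.sub_re, Complex.sub_im, Complex.mul_re, Complex.mul_im, Complex.conj_re,
    Complex.conj_im, Complex.one_re, Complex.one_im] at *
  nlinarith [mul_pos (sub_pos.2 ha2) (sub_pos.2 hw2)]

theorem discInvolution_involutive {a w : ℂ} (ha : a ∈ 𝔻) (hw : w ∈ 𝔻) :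
    discInvolution a (discInvolution a w) = w := by
  have h1 := one_sub_conj_mul_ne_zero ha hw
  have h3 := one_sub_conj_mul_ne_zero ha (discInvolution_mapsTo ha hw)
  rw [discInvolution, div_eq_iff h3, discInvolution]
  linear_combination -div_mul_cancel₀ (a - w) h1

theorem differentiableOn_discInvolution {a : ℂ} (ha : a ∈ 𝔻) :
    DifferentiableOn ℂ (discInvolution a) 𝔻 :=
  DifferentiableOn.div (by fun_prop) (by fun_prop) fun _ hw => one_sub_conj_mul_ne_zero ha hw

/-- Iterates of a self-map of the disc fixing the origin with multiplier of modulus less than one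
converge to the origin. -/
theorem tendsto_iterate_zero_of_norm_deriv_lt_one {g : ℂ → ℂ} (hg : DifferentiableOn ℂ g 𝔻)
    (hm : MapsTo g 𝔻 𝔻) (h0 : g 0 = 0) (hd : ‖deriv g 0‖ < 1) {z : ℂ} (hz : z ∈ 𝔻) :
    Tendsto (fun n => g^[n] z) atTop (𝓝 0) := by
  have hm' : MapsTo g 𝔻 (Metric.closedBall (g 0) 1) := by
    rw [h0]; exact hm.mono_right Metric.ball_subset_closedBall
  have hD0 : 𝔻 ∈ 𝓝 (0 : ℂ) := Metric.ball_mem_nhds _ one_pos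
  -- Equality in the Schwarz lemma would make `g` linear with a multiplier of modulus one, against
  -- `hd`. The maximum over the closed disk of radius ‖z‖ then gives a uniform contraction factor.
  have hlt : ∀ w ∈ 𝔻, ‖dslope g 0 w‖ < 1 := by
    intro w hw
    have hle := Complex.norm_dslope_le_div_of_mapsTo_ball hg hm' hw
    refine lt_of_le_of_ne (by simpa using hle) fun heq => ?_
    have haff := Complex.affine_of_mapsTo_ball_of_norm_dslope_eq_div hg hm' hw (by simpa using heq)
    have hda : HasDerivAt g (dslope g 0 w) 0 := by
      have h1 : HasDerivAt (fun z : ℂ => g 0 + (z - 0) • dslope g 0 w) (dslope g 0 w) 0 := by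
        simpa using (((hasDerivAt_id (0 : ℂ)).mul_const (dslope g 0 w)).const_add (g 0))
      exact h1.congr_of_eventuallyEq (by filter_upwards [hD0] with x hx using haff hx)
    rw [hda.deriv, heq] at hd
    exact lt_irrefl _ hd
  have hz1 : ‖z‖ < 1 := by simpa using hz
  have hsub : Metric.closedBall (0 : ℂ) ‖z‖ ⊆ 𝔻 := Metric.closedBall_subset_ball hz1
  obtain ⟨w, hw, hmax⟩ := (isCompact_closedBall (0 : ℂ) ‖z‖).exists_isMaxOn
    ⟨0, by simp⟩
    ((((Complex.differentiableOn_dslope hD0).2 hg).continuousOn.mono hsub).norm)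
  set q := ‖dslope g 0 w‖ with hq
  have hq1 : q < 1 := hlt w (hsub hw)
  have hstep : ∀ x, ‖x‖ ≤ ‖z‖ → ‖g x‖ ≤ q * ‖x‖ := by
    intro x hx
    have h1 : g x = x * dslope g 0 x := by
      have := sub_smul_dslope g 0 x
      rw [h0, sub_zero, sub_zero, smul_eq_mul] at this
      exact this.symm
    have h2 : ‖dslope g 0 x‖ ≤ q := hmax (by simpa using hx)
    rw [h1, norm_mul, mul_comm]
    gcongr
  have hiter : ∀ n, ‖g^[n] z‖ ≤ q ^ n * ‖z‖ := by
    intro n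
    induction n with
    | zero => simp
    | succ n ih =>
      rw [Function.iterate_succ_apply', pow_succ']
      have h1 : ‖g^[n] z‖ ≤ ‖z‖ := ih.trans
        (mul_le_of_le_one_left (norm_nonneg _) (pow_le_one₀ (norm_nonneg _) hq1.le))
      calc _ ≤ q * ‖g^[n] z‖ := hstep _ h1
        _ ≤ q * (q ^ n * ‖z‖) := by gcongr
        _ = _ := by ring
  refine squeeze_zero_norm hiter ?_
  simpa using (tendsto_pow_atTop_nhds_zero_of_lt_one (norm_nonneg _) hq1).mul_const ‖z‖

/-- Iterates of a self-map of the disc with an attracting fixed point converge to it. -/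
theorem tendsto_iterate_of_norm_deriv_lt_one {φ : ℂ → ℂ} (hφ : DifferentiableOn ℂ φ 𝔻)
    (hm : MapsTo φ 𝔻 𝔻) {z₀ a : ℂ} (hz₀ : z₀ ∈ 𝔻) (hfix : φ z₀ = z₀) (hda : HasDerivAt φ a z₀)
    (ha : ‖a‖ < 1) {z : ℂ} (hz : z ∈ 𝔻) : Tendsto (fun n => φ^[n] z) atTop (𝓝 z₀) := by
  set ψ := discInvolution z₀ with hψ
  have hψd := differentiableOn_discInvolution hz₀
  have hψm := discInvolution_mapsTo hz₀
  have h00 : (0 : ℂ) ∈ 𝔻 := Metric.mem_ball_self one_pos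
  have hD0 : 𝔻 ∈ 𝓝 (0 : ℂ) := Metric.ball_mem_nhds _ one_pos
  have hψ0 : ψ 0 = z₀ := by simp [hψ, discInvolution]
  have hψz : ψ z₀ = 0 := by simp [hψ, discInvolution]
  have d0 : HasDerivAt ψ (deriv ψ 0) 0 := (hψd.differentiableAt hD0).hasDerivAt
  have d1 : HasDerivAt ψ (deriv ψ z₀) z₀ :=
    (hψd.differentiableAt (Metric.isOpen_ball.mem_nhds hz₀)).hasDerivAt
  -- Differentiating ψ ∘ ψ = id shows that conjugation by ψ preserves the multiplier.
  have hprod : deriv ψ z₀ * deriv ψ 0 = 1 := by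
    have h1 : HasDerivAt (ψ ∘ ψ) (deriv ψ z₀ * deriv ψ 0) 0 := HasDerivAt.comp 0 (by rwa [hψ0]) d0
    refine h1.unique ((hasDerivAt_id (0 : ℂ)).congr_of_eventuallyEq ?_)
    filter_upwards [hD0] with w hw using discInvolution_involutive hz₀ hw
  set g := ψ ∘ φ ∘ ψ with hg
  have hgd : deriv g 0 = a := by
    have h1 : HasDerivAt (φ ∘ ψ) (a * deriv ψ 0) 0 := HasDerivAt.comp 0 (by rwa [hψ0]) d0
    have h2 : HasDerivAt g (deriv ψ z₀ * (a * deriv ψ 0)) 0 :=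
      HasDerivAt.comp 0 (by simpa [hψ0, hfix] using d1) h1
    rw [h2.deriv]
    linear_combination a * hprod
  have hconj : ∀ n, φ^[n] z = ψ (g^[n] (ψ z)) ∧ φ^[n] z ∈ 𝔻 := by
    intro n
    induction n with
    | zero => exact ⟨(discInvolution_involutive hz₀ hz).symm, hz⟩
    | succ n ih =>
      rw [Function.iterate_succ_apply', Function.iterate_succ_apply']
      refine ⟨?_, hm ih.2⟩
      have h1 : φ (ψ (g^[n] (ψ z))) ∈ 𝔻 := hm (by rw [← ih.1]; exact ih.2)
      rw [ih.1]
      exact (discInvolution_involutive hz₀ h1).symm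
  have ht := tendsto_iterate_zero_of_norm_deriv_lt_one (g := g)
    (hψd.comp (hφ.comp hψd hψm) (hm.comp hψm)) (hψm.comp (hm.comp hψm))
    (by simp [hg, hψ0, hfix, hψz]) (by rwa [hgd]) (hψm hz)
  have h2 := d0.continuousAt.tendsto.comp ht
  rw [hψ0] at h2
  exact h2.congr fun n => (hconj n).1.symm

variable {F : ℝ → ℂ → ℂ}

theorem IsHolSemigroup.natCast_eq_iterate (hF : IsHolSemigroup F) {z : ℂ} (hz : z ∈ 𝔻) (n : ℕ) :
    F n z = (F 1)^[n] z := by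
  induction n with
  | zero => simpa using hF.zero z hz
  | succ n ih =>
    rw [Function.iterate_succ_apply', ← ih, ← hF.add 1 n zero_le_one n.cast_nonneg z hz]
    push_cast
    rw [add_comm]

/-- The values of a semicocycle are invertible. -/
theorem IsHolSemicocycle.isUnit {A : Type*} [NormedRing A] [NormedAlgebra ℂ A] [CompleteSpace A]
    {Γ : ℝ → ℂ → A} (hF : IsHolSemigroup F) (hΓ : IsHolSemicocycle F Γ) {z : ℂ} (hz : z ∈ 𝔻)
    {t : ℝ} (ht : 0 ≤ t) : IsUnit (Γ t z) := by
  have hsmall : ∀ w ∈ 𝔻, ∀ᶠ p in 𝓝[Ici (0 : ℝ) ×ˢ 𝔻] ((0 : ℝ), w), IsUnit (Γ p.1 p.2) := by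
    intro w hw
    refine (hΓ.continuousOn (0, w) ⟨self_mem_Ici, hw⟩).eventually ?_
    simp only [hΓ.zero w hw]
    exact Units.isOpen.mem_nhds isUnit_one
  -- By the chain rule, values at nearby times differ by a left factor close to 1, so invertibility
  -- is locally constant in time and connectedness of the half-line concludes. For y < x the base
  -- point F_y z moves with y, which is where joint continuity enters.
  have hloc : ∀ x, 0 ≤ x → ∀ᶠ y in 𝓝[Ici 0] x, (IsUnit (Γ x z) ↔ IsUnit (Γ y z)) := by
    intro x hx
    have hxD := hF.mapsTo x hx hz
    have h1 : ∀ᶠ y in 𝓝[Ici 0] x, x ≤ y → IsUnit (Γ (y - x) (F x z)) := by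
      have ht : Tendsto (fun y : ℝ => (max (y - x) 0, F x z)) (𝓝[Ici 0] x)
          (𝓝[Ici (0 : ℝ) ×ˢ 𝔻] ((0 : ℝ), F x z)) := by
        refine tendsto_nhdsWithin_iff.2 ⟨?_, Eventually.of_forall fun y =>
          ⟨mem_Ici.2 (le_max_right _ _), hxD⟩⟩
        have hc : Continuous fun y : ℝ => (max (y - x) 0, F x z) := by fun_prop
        have := hc.tendsto x
        simp only [sub_self, max_self] at this
        exact this.mono_left nhdsWithin_le_nhds
      filter_upwards [ht.eventually (hsmall _ hxD)] with y hy hxy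
      simpa [max_eq_left (sub_nonneg.2 hxy)] using hy
    have h2 : ∀ᶠ y in 𝓝[Ici 0] x, y ≤ x → IsUnit (Γ (x - y) (F y z)) := by
      have ht : Tendsto (fun y : ℝ => (max (x - y) 0, F y z)) (𝓝[Ici 0] x)
          (𝓝[Ici (0 : ℝ) ×ˢ 𝔻] ((0 : ℝ), F x z)) := by
        refine tendsto_nhdsWithin_iff.2 ⟨?_, ?_⟩
        · have hc : Continuous fun y : ℝ => max (x - y) 0 := by fun_prop
          have := hc.tendsto x
          simp only [sub_self, max_self] at this
          exact (this.mono_left nhdsWithin_le_nhds).prodMk_nhds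
            (hF.continuousOn_orbit hz x hx)
        · filter_upwards [self_mem_nhdsWithin] with y hy
          exact ⟨mem_Ici.2 (le_max_right _ _), hF.mapsTo y hy hz⟩
      filter_upwards [ht.eventually (hsmall _ hxD)] with y hy hxy
      simpa [max_eq_left (sub_nonneg.2 hxy)] using hy
    filter_upwards [h1, h2, self_mem_nhdsWithin] with y hy1 hy2 hy0
    rcases le_total x y with hxy | hyx
    · have hc := hΓ.chain (y - x) x (sub_nonneg.2 hxy) hx z hz
      rw [sub_add_cancel] at hc
      obtain ⟨u, hu⟩ := hy1 hxy
      rw [← hc, ← hu, Units.isUnit_units_mul]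
    · have hc := hΓ.chain (x - y) y (sub_nonneg.2 hyx) hy0 z hz
      rw [sub_add_cancel] at hc
      obtain ⟨u, hu⟩ := hy2 hyx
      rw [← hc, ← hu, Units.isUnit_units_mul]
  have hp : IsPreconnected (Ici (0 : ℝ)) := isPreconnected_Ici
  have := hp.induction₂ (fun x y => IsUnit (Γ x z) ↔ IsUnit (Γ y z)) hloc
    (fun x y w _ _ _ h h' => h.trans h') (fun x y _ _ h => h.symm) self_mem_Ici ht
  rw [← this, hΓ.zero z hz]
  exact isUnit_one

end DiscDynamics

/-! ### Leading Taylor coefficients through `IsBigO` estimates. -/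

section LeadingCoefficient

variable {E : Type*} [NormedAddCommGroup E] [NormedSpace ℂ E]

theorem pow_smul_sub_isBigO {g : ℂ → E} {z₀ : ℂ} (hg : DifferentiableAt ℂ g z₀) (k : ℕ) :
    (fun z => (z - z₀) ^ k • g z - (z - z₀) ^ k • g z₀) =O[𝓝 z₀] fun z => (z - z₀) ^ (k + 1) := by
  have h := (isBigO_refl (fun z : ℂ => (z - z₀) ^ k) (𝓝 z₀)).smul hg.hasDerivAt.isBigO_sub
  simpa [smul_sub, pow_succ] using h

/-- An analytic function vanishing to order `k` has a leading coefficient of order `k`. -/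
theorem exists_leading_coeff {h : ℂ → E} {z₀ : ℂ} (ha : AnalyticAt ℂ h z₀) {k : ℕ}
    (hO : h =O[𝓝 z₀] fun z => (z - z₀) ^ k) :
    ∃ X : E, (fun z => h z - (z - z₀) ^ k • X) =O[𝓝 z₀] fun z => (z - z₀) ^ (k + 1) := by
  -- If the order were n < k, the cofactor `g` would be bounded by C ‖z - z₀‖^(k - n) off z₀,
  -- forcing g(z₀) = 0.
  have hk : (k : ℕ∞) ≤ analyticOrderAt h z₀ := by
    by_contra! hlt
    obtain ⟨n, hn⟩ := ENat.ne_top_iff_exists.1 hlt.ne_top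
    obtain ⟨g, hga, hg0, hg⟩ := (ha.analyticOrderAt_eq_natCast).1 hn.symm
    rw [← hn, Nat.cast_lt] at hlt
    obtain ⟨C, hC⟩ := hO.bound
    refine hg0 (norm_le_zero_iff.1 ?_)
    have h1 : Tendsto (fun z => ‖g z‖) (𝓝[≠] z₀) (𝓝 ‖g z₀‖) :=
      hga.continuousAt.norm.tendsto.mono_left nhdsWithin_le_nhds
    have h2 : Tendsto (fun z => C * ‖z - z₀‖ ^ (k - n)) (𝓝[≠] z₀) (𝓝 0) := by
      have hc : Continuous fun z : ℂ => C * ‖z - z₀‖ ^ (k - n) := by fun_prop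
      have := hc.tendsto z₀
      simp only [sub_self, norm_zero, zero_pow (Nat.sub_ne_zero_of_lt hlt), mul_zero] at this
      exact this.mono_left nhdsWithin_le_nhds
    refine le_of_tendsto_of_tendsto h1 h2 ?_
    filter_upwards [nhdsWithin_le_nhds hC, nhdsWithin_le_nhds hg, self_mem_nhdsWithin]
      with z hz1 hz2 hz3
    have hpos : 0 < ‖z - z₀‖ := norm_pos_iff.2 (sub_ne_zero.2 hz3)
    rw [hz2, norm_smul, norm_pow, norm_pow, ← Nat.sub_add_cancel hlt.le, pow_add] at hz1
    have : ‖z - z₀‖ ^ n * ‖g z‖ ≤ ‖z - z₀‖ ^ n * (C * ‖z - z₀‖ ^ (k - n)) := by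
      linarith
    exact le_of_mul_le_mul_left this (by positivity)
  obtain ⟨g, hga, hg⟩ := (natCast_le_analyticOrderAt ha).1 hk
  refine ⟨g z₀, (pow_smul_sub_isBigO hga.differentiableAt k).congr' ?_ EventuallyEq.rfl⟩
  filter_upwards [hg] with z hz
  rw [hz]

theorem eq_zero_of_pow_smul_isBigO {X : E} {z₀ : ℂ} {k : ℕ}
    (hO : (fun z => (z - z₀) ^ k • X) =O[𝓝 z₀] fun z => (z - z₀) ^ (k + 1)) : X = 0 := by
  obtain ⟨C, hC⟩ := hO.bound
  have h2 : Tendsto (fun z => C * ‖z - z₀‖) (𝓝[≠] z₀) (𝓝 0) := by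
    have hc : Continuous fun z : ℂ => C * ‖z - z₀‖ := by fun_prop
    have := hc.tendsto z₀
    simp only [sub_self, norm_zero, mul_zero] at this
    exact this.mono_left nhdsWithin_le_nhds
  refine norm_le_zero_iff.1 (ge_of_tendsto h2 ?_)
  filter_upwards [nhdsWithin_le_nhds hC, self_mem_nhdsWithin] with z hz1 hz3
  have hpos : 0 < ‖z - z₀‖ := norm_pos_iff.2 (sub_ne_zero.2 hz3)
  rw [norm_smul, norm_pow, norm_pow, pow_succ] at hz1
  have : ‖z - z₀‖ ^ k * ‖X‖ ≤ ‖z - z₀‖ ^ k * (C * ‖z - z₀‖) := by linarith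
  exact le_of_mul_le_mul_left this (by positivity)

theorem pow_isBigO_pow_of_le (z₀ : ℂ) {m n : ℕ} (h : m ≤ n) :
    (fun z : ℂ => (z - z₀) ^ n) =O[𝓝 z₀] fun z => (z - z₀) ^ m := by
  obtain ⟨d, rfl⟩ := Nat.exists_eq_add_of_le h
  have h1 : (fun z : ℂ => (z - z₀) ^ d) =O[𝓝 z₀] fun _ => (1 : ℂ) :=
    (show Continuous fun z : ℂ => (z - z₀) ^ d by fun_prop).continuousAt.tendsto.isBigO_one ℂ
  simpa [pow_add] using (isBigO_refl (fun z : ℂ => (z - z₀) ^ m) (𝓝 z₀)).mul h1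

end LeadingCoefficient

/-! ### The homological operator and resonances. -/

section HomologicalOperator

variable {A : Type*} [NormedRing A] [NormedAlgebra ℂ A]

/-- The operator `a ↦ e^{-μτ} e^{-τB} a e^{τB} - a`. -/
noncomputable def homologicalOp (B : A) (μ τ : ℂ) : A →L[ℂ] A :=
  Complex.exp (-μ * τ) • (ContinuousLinearMap.mul ℂ A (NormedSpace.exp ((-τ) • B)) *
    (ContinuousLinearMap.mul ℂ A).flip (NormedSpace.exp (τ • B))) - 1

theorem homologicalOp_apply (B : A) (μ τ : ℂ) (a : A) :
    homologicalOp B μ τ a = Complex.exp (-μ * τ) •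
      (NormedSpace.exp ((-τ) • B) * a * NormedSpace.exp (τ • B)) - a := by
  simp [homologicalOp, mul_assoc]

variable [CompleteSpace A]

/-- The product rule at τ = 0. This brings in the spectral hypothesis: the operator is τ (ad_B - μ)
to first order. -/
theorem hasDerivAt_homologicalOp (B : A) (μ : ℂ) :
    HasDerivAt (homologicalOp B μ) (adOp B - algebraMap ℂ (A →L[ℂ] A) μ) 0 := by
  have h1 : HasDerivAt (fun τ : ℂ => Complex.exp (-μ * τ)) (-μ) 0 := by
    simpa using ((hasDerivAt_id (0 : ℂ)).const_mul (-μ)).cexp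
  have e1 : HasDerivAt (fun τ : ℂ => NormedSpace.exp ((-τ) • B)) (-B) 0 := by
    simpa using hasDerivAt_exp_smul_const (𝕂 := ℂ) (-B) 0
  have e2 : HasDerivAt (fun τ : ℂ => NormedSpace.exp (τ • B)) B 0 := by
    simpa using hasDerivAt_exp_smul_const (𝕂 := ℂ) B 0
  have h2 := (ContinuousLinearMap.mul ℂ A).hasFDerivAt.comp_hasDerivAt (0 : ℂ) e1
  have h3 := (ContinuousLinearMap.mul ℂ A).flip.hasFDerivAt.comp_hasDerivAt (0 : ℂ) e2
  refine ((h1.smul (h2.mul h3)).sub_const 1).congr_deriv ?_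
  ext a
  simp [adOp_apply, Algebra.algebraMap_eq_smul_one]
  abel

/-- Off the spectrum of `ad B`, the homological operator is invertible for small times. -/
theorem eventually_isUnit_homologicalOp {B : A} {μ : ℂ} (hμ : μ ∉ spectrum ℂ (adOp B)) :
    ∀ᶠ τ in 𝓝[≠] (0 : ℂ), IsUnit (homologicalOp B μ τ) := by
  have hu : IsUnit (adOp B - algebraMap ℂ (A →L[ℂ] A) μ) := by
    have := (spectrum.notMem_iff.1 hμ).neg
    simpa using this
  have h0 : homologicalOp B μ 0 = 0 := by
    ext a; simp [homologicalOp_apply]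
  have ht := hasDerivAt_iff_tendsto_slope.1 (hasDerivAt_homologicalOp B μ)
  filter_upwards [ht.eventually (Units.isOpen.mem_nhds hu), self_mem_nhdsWithin] with τ hτ hτ0
  have : homologicalOp B μ τ = algebraMap ℂ (A →L[ℂ] A) τ * slope (homologicalOp B μ) 0 τ := by
    rw [slope_def_module, h0, ← Algebra.smul_def, sub_zero, sub_zero, smul_smul,
      mul_inv_cancel₀ hτ0, one_smul]
  rw [this]
  exact ((isUnit_iff_ne_zero.2 hτ0).map _).mul hτ

end HomologicalOperator

/-! ### Transfer operators acting on jets at the fixed point. -/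

section Transfer

variable {A : Type*} [NormedRing A] [NormedAlgebra ℂ A]

local notation "𝔻" => Metric.ball (0 : ℂ) 1

/-- A semicocycle over a semigroup with fixed point `z₀` of multiplier `e^{-λt}`, equal to
`e^{tB}` at the fixed point. -/
structure IsCocycleAtFixedPoint (F : ℝ → ℂ → ℂ) (Γ : ℝ → ℂ → A) (z₀ lam : ℂ) (B : A) : Prop where
  semigroup : IsHolSemigroup F
  cocycle : IsHolSemicocycle F Γ
  mem : z₀ ∈ 𝔻
  fixed : ∀ t, 0 ≤ t → F t z₀ = z₀
  hasDerivAt : ∀ t : ℝ, 0 ≤ t → HasDerivAt (F t) (Complex.exp (-lam * t)) z₀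
  value : ∀ t : ℝ, 0 ≤ t → Γ t z₀ = NormedSpace.exp ((t : ℂ) • B)

/-- The operators `h ↦ e^{-sB} (h ∘ F s) Γ s`, whose common fixed points linearize `Γ`. -/
noncomputable def transfer (F : ℝ → ℂ → ℂ) (Γ : ℝ → ℂ → A) (B : A) (s : ℝ) (h : ℂ → A) (z : ℂ) :
    A :=
  NormedSpace.exp ((-(s : ℂ)) • B) * h (F s z) * Γ s z

namespace IsCocycleAtFixedPoint

variable {F : ℝ → ℂ → ℂ} {Γ : ℝ → ℂ → A} {z₀ lam : ℂ} {B : A}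

theorem mem_nhds (H : IsCocycleAtFixedPoint F Γ z₀ lam B) : 𝔻 ∈ 𝓝 z₀ :=
  Metric.isOpen_ball.mem_nhds H.mem

theorem differentiableOn_transfer (H : IsCocycleAtFixedPoint F Γ z₀ lam B) {s : ℝ} (hs : 0 ≤ s)
    {h : ℂ → A} (hh : DifferentiableOn ℂ h 𝔻) : DifferentiableOn ℂ (transfer F Γ B s h) 𝔻 :=
  ((differentiableOn_const _).mul
    (hh.comp (H.semigroup.holomorphic s hs) (H.semigroup.mapsTo s hs))).mul
    (H.cocycle.holomorphic s hs)

theorem transfer_sub (s : ℝ) (h g : ℂ → A) (z : ℂ) :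
    transfer F Γ B s (h - g) z = transfer F Γ B s h z - transfer F Γ B s g z := by
  simp [transfer, mul_sub, sub_mul]

theorem transfer_add_fun (s : ℝ) (h g : ℂ → A) (z : ℂ) :
    transfer F Γ B s (h + g) z = transfer F Γ B s h z + transfer F Γ B s g z := by
  simp [transfer, mul_add, add_mul]

theorem tendsto_flow (H : IsCocycleAtFixedPoint F Γ z₀ lam B) {s : ℝ} (hs : 0 ≤ s) :
    Tendsto (F s) (𝓝 z₀) (𝓝 z₀) := by
  simpa [H.fixed s hs] using (H.hasDerivAt s hs).continuousAt.tendsto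

theorem differentiableAt_cocycle (H : IsCocycleAtFixedPoint F Γ z₀ lam B) {s : ℝ} (hs : 0 ≤ s) :
    DifferentiableAt ℂ (Γ s) z₀ :=
  (H.cocycle.holomorphic s hs).differentiableAt H.mem_nhds

theorem transfer_isBigO (H : IsCocycleAtFixedPoint F Γ z₀ lam B) {s : ℝ} (hs : 0 ≤ s)
    {h : ℂ → A} {k : ℕ} (hh : h =O[𝓝 z₀] fun z => (z - z₀) ^ k) :
    transfer F Γ B s h =O[𝓝 z₀] fun z => (z - z₀) ^ k := by
  have h1 : (fun z => h (F s z)) =O[𝓝 z₀] fun z => (F s z - z₀) ^ k :=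
    hh.comp_tendsto (H.tendsto_flow hs)
  have h2 : (fun z => F s z - z₀) =O[𝓝 z₀] fun z => z - z₀ := by
    simpa [H.fixed s hs] using (H.hasDerivAt s hs).isBigO_sub
  have h3 : Γ s =O[𝓝 z₀] fun _ => (1 : ℂ) :=
    (H.differentiableAt_cocycle hs).continuousAt.tendsto.isBigO_one ℂ
  have h4 : (fun _ : ℂ => NormedSpace.exp ((-(s : ℂ)) • B)) =O[𝓝 z₀] fun _ => (1 : ℂ) :=
    isBigO_const_const _ one_ne_zero _
  exact ((h4.mul (h1.trans (h2.pow k))).mul h3).congr_right fun z => by simp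

/-- Writing F_τ z - z₀ as (z - z₀) times a divided difference pulls out (z - z₀)^k; the cofactor is
differentiable, and replacing it by its value at z₀ costs one order. -/
theorem transfer_monomial_isBigO (H : IsCocycleAtFixedPoint F Γ z₀ lam B) {τ : ℝ} (hτ : 0 ≤ τ)
    (k : ℕ) (X : A) :
    (fun z => transfer F Γ B τ (fun w => (w - z₀) ^ k • X) z - (z - z₀) ^ k • X -
      (z - z₀) ^ k • homologicalOp B (lam * k) τ X) =O[𝓝 z₀] fun z => (z - z₀) ^ (k + 1) := by
  have hd : DifferentiableAt ℂ (dslope (F τ) z₀) z₀ :=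
    ((Complex.differentiableOn_dslope H.mem_nhds).2
      (H.semigroup.holomorphic τ hτ)).differentiableAt H.mem_nhds
  have hg : DifferentiableAt ℂ (fun z => dslope (F τ) z₀ z ^ k •
      (NormedSpace.exp ((-(τ : ℂ)) • B) * X * Γ τ z)) z₀ :=
    (hd.pow k).smul ((differentiableAt_const _).mul (H.differentiableAt_cocycle hτ))
  refine (pow_smul_sub_isBigO hg k).congr_left fun z => ?_
  have h1 : F τ z - z₀ = (z - z₀) * dslope (F τ) z₀ z := by
    have := sub_smul_dslope (F τ) z₀ z
    rw [H.fixed τ hτ, smul_eq_mul] at this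
    exact this.symm
  have h2 : dslope (F τ) z₀ z₀ ^ k = Complex.exp (-(lam * k) * τ) := by
    rw [dslope_same, (H.hasDerivAt τ hτ).deriv, ← Complex.exp_nat_mul]
    congr 1; ring
  rw [transfer, h1, mul_pow, homologicalOp_apply, h2, H.value τ hτ]
  simp only [mul_smul_comm, smul_mul_assoc, smul_smul, smul_sub]
  abel

theorem analyticAt [CompleteSpace A] (H : IsCocycleAtFixedPoint F Γ z₀ lam B) {h : ℂ → A}
    (hh : DifferentiableOn ℂ h 𝔻) : AnalyticAt ℂ h z₀ :=
  hh.analyticAt H.mem_nhds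

variable [CompleteSpace A]

theorem transfer_transfer (H : IsCocycleAtFixedPoint F Γ z₀ lam B) {s t : ℝ} (hs : 0 ≤ s)
    (ht : 0 ≤ t) (h : ℂ → A) {z : ℂ} (hz : z ∈ 𝔻) :
    transfer F Γ B s (transfer F Γ B t h) z = transfer F Γ B (t + s) h z := by
  have e : (-((t + s : ℝ) : ℂ)) = -(s : ℂ) + -(t : ℂ) := by push_cast; ring
  rw [transfer, transfer, transfer, e, exp_add_smul, H.semigroup.add t s ht hs z hz,
    ← H.cocycle.chain t s ht hs z hz]
  simp only [mul_assoc]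

theorem transfer_comm (H : IsCocycleAtFixedPoint F Γ z₀ lam B) {s t : ℝ} (hs : 0 ≤ s)
    (ht : 0 ≤ t) (h : ℂ → A) {z : ℂ} (hz : z ∈ 𝔻) :
    transfer F Γ B s (transfer F Γ B t h) z = transfer F Γ B t (transfer F Γ B s h) z := by
  rw [H.transfer_transfer hs ht h hz, H.transfer_transfer ht hs h hz, add_comm]

theorem transfer_apply_fixed (H : IsCocycleAtFixedPoint F Γ z₀ lam B) {s : ℝ} (hs : 0 ≤ s)
    {h : ℂ → A} (h1 : h z₀ = 1) : transfer F Γ B s h z₀ = 1 := by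
  rw [transfer, H.fixed s hs, h1, H.value s hs, mul_one, exp_neg_smul_mul_exp_smul]

/-- An approximate fixed point of a transfer operator can be corrected to one order higher. -/
theorem exists_correction (H : IsCocycleAtFixedPoint F Γ z₀ lam B) {τ : ℝ} (hτ : 0 ≤ τ) {k : ℕ}
    (hu : IsUnit (homologicalOp B (lam * k) τ)) {h : ℂ → A} (hh : DifferentiableOn ℂ h 𝔻)
    (hO : (transfer F Γ B τ h - h) =O[𝓝 z₀] fun z => (z - z₀) ^ k) :
    ∃ X : A, (transfer F Γ B τ (h + fun w => (w - z₀) ^ k • X) - (h + fun w => (w - z₀) ^ k • X))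
      =O[𝓝 z₀] fun z => (z - z₀) ^ (k + 1) := by
  obtain ⟨Y, hY⟩ := exists_leading_coeff
    (H.analyticAt ((H.differentiableOn_transfer hτ hh).sub hh)) hO
  obtain ⟨T, hT⟩ := hu
  -- The coefficient solves the homological equation with right-hand side -Y, cancelling the leading
  -- term of the defect.
  refine ⟨-((↑T⁻¹ : A →L[ℂ] A) Y), (hY.add
    (H.transfer_monomial_isBigO hτ k (-((↑T⁻¹ : A →L[ℂ] A) Y)))).congr_left fun z => ?_⟩
  have hTY : homologicalOp B (lam * k) τ (-((↑T⁻¹ : A →L[ℂ] A) Y)) = -Y := by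
    rw [← hT, map_neg, ← mul_apply_eq_comp, Units.mul_inv,
      one_apply_eq_self]
  rw [hTY]
  simp only [Pi.sub_apply, transfer_add_fun, Pi.add_apply, smul_neg]
  abel

/-- Without resonances, an approximate fixed point vanishing to order `k` vanishes to a higher
order. -/
theorem isBigO_succ_of_transfer_sub (H : IsCocycleAtFixedPoint F Γ z₀ lam B) {τ : ℝ} (hτ : 0 ≤ τ)
    {k : ℕ} (hu : IsUnit (homologicalOp B (lam * k) τ)) {h : ℂ → A}
    (hh : DifferentiableOn ℂ h 𝔻) (hk : h =O[𝓝 z₀] fun z => (z - z₀) ^ k)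
    (hO : (transfer F Γ B τ h - h) =O[𝓝 z₀] fun z => (z - z₀) ^ (k + 1)) :
    h =O[𝓝 z₀] fun z => (z - z₀) ^ (k + 1) := by
  obtain ⟨X, hX⟩ := exists_leading_coeff (H.analyticAt hh) hk
  obtain ⟨T, hT⟩ := hu
  have h1 := H.transfer_isBigO hτ hX
  have h2 : (fun z => (z - z₀) ^ k • homologicalOp B (lam * k) τ X) =O[𝓝 z₀]
      fun z => (z - z₀) ^ (k + 1) := by
    refine (((hO.sub h1).add hX).sub (H.transfer_monomial_isBigO hτ k X)).congr_left fun z => ?_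
    have := transfer_sub (F := F) (Γ := Γ) (B := B) τ h (fun w => (w - z₀) ^ k • X) z
    simp only [Pi.sub_apply]
    rw [show (fun z => h z - (z - z₀) ^ k • X) = h - fun w => (w - z₀) ^ k • X from rfl, this]
    abel
  have h3 := eq_zero_of_pow_smul_isBigO h2
  have h4 : X = 0 := by
    have : (↑T⁻¹ : A →L[ℂ] A) ((T : A →L[ℂ] A) X) = X := by
      rw [← mul_apply_eq_comp, Units.inv_mul, one_apply_eq_self]
    rw [← this, hT, h3, map_zero]
  simpa [h4] using hX

end IsCocycleAtFixedPoint

end Transfer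

/-! ### From approximate to exact fixed points. -/

namespace IsCocycleAtFixedPoint

variable {A : Type*} [NormedRing A] [NormedAlgebra ℂ A]
  {F : ℝ → ℂ → ℂ} {Γ : ℝ → ℂ → A} {z₀ lam : ℂ} {B : A}

local notation "𝔻" => Metric.ball (0 : ℂ) 1

theorem isBigO_pow_one_of_apply_eq_zero (H : IsCocycleAtFixedPoint F Γ z₀ lam B) {h : ℂ → A}
    (hh : DifferentiableOn ℂ h 𝔻) (h0 : h z₀ = 0) : h =O[𝓝 z₀] fun z => (z - z₀) ^ (0 + 1) := by
  simpa [h0] using (hh.differentiableAt H.mem_nhds).hasDerivAt.isBigO_sub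

theorem iterate_transfer_sub (s : ℝ) (h g : ℂ → A) (m : ℕ) :
    (transfer F Γ B s)^[m] (h - g) = (transfer F Γ B s)^[m] h - (transfer F Γ B s)^[m] g := by
  induction m generalizing h g with
  | zero => rfl
  | succ m ih =>
    rw [Function.iterate_succ_apply, Function.iterate_succ_apply, Function.iterate_succ_apply, ← ih]
    congr 1
    funext z
    exact transfer_sub s h g z

/-- On functions vanishing to order `n` the iterates of the time-one transfer operator decay
geometrically near the fixed point. -/
theorem exists_iterate_bound (H : IsCocycleAtFixedPoint F Γ z₀ lam B) {q κ : ℝ} (hq0 : 0 ≤ q)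
    (hq1 : q ≤ 1) (hq : ∀ᶠ z in 𝓝 z₀, ‖F 1 z - z₀‖ ≤ q * ‖z - z₀‖)
    (hκ : ∀ᶠ z in 𝓝 z₀, ‖Γ 1 z‖ ≤ κ) {n : ℕ} {h : ℂ → A}
    (hO : h =O[𝓝 z₀] fun z => (z - z₀) ^ n) :
    ∃ r > 0, ∃ C, 0 ≤ C ∧ Metric.ball z₀ r ⊆ 𝔻 ∧ ∀ j : ℕ, ∀ z ∈ Metric.ball z₀ r,
      ‖(transfer F Γ B 1)^[j] h z‖ ≤ C * ‖z - z₀‖ ^ n *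
        (‖NormedSpace.exp ((-((1 : ℝ) : ℂ)) • B)‖ * κ * q ^ n) ^ j := by
  obtain ⟨C, hC0, hC⟩ := hO.exists_nonneg
  obtain ⟨r, hr, hball⟩ := Metric.eventually_nhds_iff_ball.1
    ((hq.and hκ).and (hC.bound.and H.mem_nhds))
  refine ⟨r, hr, C, hC0, fun z hz => (hball z hz).2.2, fun j => ?_⟩
  induction j with
  | zero =>
    intro z hz
    simpa using (hball z hz).2.1
  | succ j ih =>
    intro z hz
    obtain ⟨⟨h1, h2⟩, -⟩ := hball z hz
    -- Since q ≤ 1 the ball is invariant, so the induction hypothesis applies at F_1 z and its n-th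
    -- order vanishing yields the factor q^n.
    have hFz : F 1 z ∈ Metric.ball z₀ r := by
      rw [Metric.mem_ball, dist_eq_norm] at hz ⊢
      exact (h1.trans (mul_le_of_le_one_left (norm_nonneg _) hq1)).trans_lt hz
    have hκ0 : 0 ≤ κ := (norm_nonneg _).trans h2
    rw [Function.iterate_succ_apply', transfer]
    set E := ‖NormedSpace.exp ((-((1 : ℝ) : ℂ)) • B)‖ with hE
    have hE0 : 0 ≤ E := norm_nonneg _
    calc _ ≤ E * ‖(transfer F Γ B 1)^[j] h (F 1 z)‖ * ‖Γ 1 z‖ :=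
          (norm_mul_le _ _).trans (mul_le_mul_of_nonneg_right (norm_mul_le _ _) (norm_nonneg _))
      _ ≤ E * (C * (q * ‖z - z₀‖) ^ n * (E * κ * q ^ n) ^ j) * κ := by
          have := (ih _ hFz).trans (mul_le_mul_of_nonneg_right
            (mul_le_mul_of_nonneg_left (pow_le_pow_left₀ (norm_nonneg _) h1 n) hC0)
            (by positivity))
          gcongr
      _ = _ := by rw [mul_pow]; ring

variable [CompleteSpace A]

/-- Without resonances there are approximate fixed points of every order. -/
theorem exists_approx (H : IsCocycleAtFixedPoint F Γ z₀ lam B) {τ : ℝ} (hτ : 0 ≤ τ) (N : ℕ)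
    (hu : ∀ k ∈ Finset.Icc 1 N, IsUnit (homologicalOp B (lam * (k : ℕ)) τ)) :
    ∃ P : ℂ → A, DifferentiableOn ℂ P 𝔻 ∧ P z₀ = 1 ∧
      (transfer F Γ B τ P - P) =O[𝓝 z₀] fun z => (z - z₀) ^ (N + 1) := by
  induction N with
  | zero =>
    have h1 : DifferentiableOn ℂ (fun _ : ℂ => (1 : A)) 𝔻 := differentiableOn_const _
    refine ⟨fun _ => 1, h1, rfl, H.isBigO_pow_one_of_apply_eq_zero
      ((H.differentiableOn_transfer hτ h1).sub h1) ?_⟩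
    rw [Pi.sub_apply, H.transfer_apply_fixed hτ rfl, sub_self]
  | succ N ih =>
    obtain ⟨P, hP, hP1, hPO⟩ := ih fun k hk =>
      hu k (Finset.Icc_subset_Icc_right N.le_succ hk)
    obtain ⟨X, hX⟩ := H.exists_correction hτ (hu (N + 1) (by simp)) hP hPO
    refine ⟨_, hP.add ?_, ?_, hX⟩
    · fun_prop
    · simp [hP1]

/-- Telescoping, since each T_{mτ} preserves the order of vanishing. Used to pass from a small τ to
time one. -/
theorem transfer_nat_mul_sub_isBigO (H : IsCocycleAtFixedPoint F Γ z₀ lam B) {τ : ℝ} (hτ : 0 ≤ τ)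
    {n : ℕ} {P : ℂ → A} (hO : (transfer F Γ B τ P - P) =O[𝓝 z₀] fun z => (z - z₀) ^ n) (m : ℕ) :
    (transfer F Γ B (m * τ) P - P) =O[𝓝 z₀] fun z => (z - z₀) ^ n := by
  induction m with
  | zero =>
    refine (isBigO_zero _ _).congr' ?_ EventuallyEq.rfl
    filter_upwards [H.mem_nhds] with z hz
    simp [transfer, H.semigroup.zero z hz, H.cocycle.zero z hz]
  | succ m ih =>
    have hm : 0 ≤ (m : ℝ) * τ := by positivity
    refine ((H.transfer_isBigO hm hO).add ih).congr' ?_ EventuallyEq.rfl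
    filter_upwards [H.mem_nhds] with z hz
    have e : ((m + 1 : ℕ) : ℝ) * τ = τ + m * τ := by push_cast; ring
    rw [transfer_sub, Pi.sub_apply, Pi.sub_apply, H.transfer_transfer hm hτ P hz, e]
    abel

theorem iterate_transfer_one (H : IsCocycleAtFixedPoint F Γ z₀ lam B) (h : ℂ → A) (m : ℕ) {z : ℂ}
    (hz : z ∈ 𝔻) : (transfer F Γ B 1)^[m] h z = transfer F Γ B m h z := by
  induction m generalizing h with
  | zero => simp [transfer, H.semigroup.zero z hz, H.cocycle.zero z hz]
  | succ m ih =>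
    rw [Function.iterate_succ_apply, ih, H.transfer_transfer m.cast_nonneg zero_le_one h hz]
    push_cast
    rw [add_comm]

/-- Close to an approximate fixed point of sufficiently high order there is a fixed point of the
time-one transfer operator. -/
theorem exists_fixed_of_approx (H : IsCocycleAtFixedPoint F Γ z₀ lam B)
    (hconv : ∀ z ∈ 𝔻, Tendsto (fun n : ℕ => F n z) atTop (𝓝 z₀)) {q κ : ℝ} (hq0 : 0 ≤ q)
    (hq1 : q ≤ 1) (hq : ∀ᶠ z in 𝓝 z₀, ‖F 1 z - z₀‖ ≤ q * ‖z - z₀‖)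
    (hκ : ∀ᶠ z in 𝓝 z₀, ‖Γ 1 z‖ ≤ κ) {n : ℕ}
    (hρ : ‖NormedSpace.exp ((-((1 : ℝ) : ℂ)) • B)‖ * κ * q ^ n < 1) {P : ℂ → A}
    (hP : DifferentiableOn ℂ P 𝔻)
    (hO : (transfer F Γ B 1 P - P) =O[𝓝 z₀] fun z => (z - z₀) ^ n) :
    ∃ M : ℂ → A, DifferentiableOn ℂ M 𝔻 ∧ (∀ z ∈ 𝔻, transfer F Γ B 1 M z = M z) ∧
      (M - P) =O[𝓝 z₀] fun z => (z - z₀) ^ n := by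
  obtain ⟨r, hr, C, hC0, hsub, hbound⟩ := H.exists_iterate_bound hq0 hq1 hq hκ hO
  set T := transfer F Γ B 1 with hT
  set ρ := ‖NormedSpace.exp ((-((1 : ℝ) : ℂ)) • B)‖ * κ * q ^ n with hρdef
  have hρ0 : 0 ≤ ρ := by
    obtain ⟨z, hz⟩ := hκ.exists
    have : 0 ≤ κ := (norm_nonneg _).trans hz
    positivity
  have hdist : ∀ z ∈ Metric.ball z₀ r, ∀ j : ℕ,
      dist (T^[j] P z) (T^[j + 1] P z) ≤ C * ‖z - z₀‖ ^ n * ρ ^ j := by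
    intro z hz j
    rw [dist_comm, dist_eq_norm, Function.iterate_succ_apply, ← Pi.sub_apply,
      ← iterate_transfer_sub]
    exact hbound j z hz
  have hlimU : ∀ z ∈ Metric.ball z₀ r, ∃ a, Tendsto (fun j => T^[j] P z) atTop (𝓝 a) :=
    fun z hz => cauchySeq_tendsto_of_complete (cauchySeq_of_le_geometric ρ _ hρ (hdist z hz))
  -- Expresses late iterates at z through iterates at F_m z, which lies in the small ball for a
  -- suitable m; this extends convergence to the whole disk.
  have hshift : ∀ z ∈ 𝔻, ∀ m j : ℕ, T^[j + m] P z =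
      NormedSpace.exp ((-((m : ℝ) : ℂ)) • B) * T^[j] P (F m z) * Γ m z := by
    intro z hz m j
    rw [add_comm, Function.iterate_add_apply, H.iterate_transfer_one _ m hz, transfer]
  have hlim : ∀ z ∈ 𝔻, ∃ a, Tendsto (fun j => T^[j] P z) atTop (𝓝 a) := by
    intro z hz
    obtain ⟨m, hm⟩ := ((hconv z hz).eventually (Metric.ball_mem_nhds z₀ hr)).exists
    obtain ⟨a, ha⟩ := hlimU _ hm
    refine ⟨NormedSpace.exp ((-((m : ℝ) : ℂ)) • B) * a * Γ m z,
      (tendsto_add_atTop_iff_nat m).1 ?_⟩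
    simp only [hshift z hz m]
    exact (ha.const_mul _).mul_const _
  choose! M hM using hlim
  have hMT : ∀ z ∈ 𝔻, ∀ m : ℕ, transfer F Γ B m M z = M z := by
    intro z hz m
    refine tendsto_nhds_unique ?_ ((tendsto_add_atTop_iff_nat m).2 (hM z hz))
    simp only [hshift z hz m]
    exact ((hM _ (H.semigroup.mapsTo m m.cast_nonneg hz)).const_mul _).mul_const _
  have hMU : DifferentiableOn ℂ M (Metric.ball z₀ r) := by
    have hdiff : ∀ j, DifferentiableOn ℂ (T^[j] P) 𝔻 := by
      intro j
      induction j with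
      | zero => exact hP
      | succ j ih =>
        rw [Function.iterate_succ_apply']
        exact H.differentiableOn_transfer zero_le_one ih
    refine TendstoLocallyUniformlyOn.differentiableOn (F := fun j => T^[j] P) (φ := atTop) ?_
      (Eventually.of_forall fun j => (hdiff j).mono hsub) Metric.isOpen_ball
    refine TendstoUniformlyOn.tendstoLocallyUniformlyOn ?_
    rw [Metric.tendstoUniformlyOn_iff]
    intro ε hε
    have h0 : Tendsto (fun j : ℕ => C * r ^ n * ρ ^ j / (1 - ρ)) atTop (𝓝 0) := by
      simpa using ((tendsto_pow_atTop_nhds_zero_of_lt_one hρ0 hρ).const_mul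
        (C * r ^ n)).div_const (1 - ρ)
    filter_upwards [h0.eventually_lt_const hε] with j hj z hz
    rw [dist_comm]
    refine (dist_le_of_le_geometric_of_tendsto ρ _ hρ (hdist z hz) (hM z (hsub hz)) j).trans_lt
      (lt_of_le_of_lt ?_ hj)
    rw [Metric.mem_ball, dist_eq_norm] at hz
    have : 0 < 1 - ρ := sub_pos.2 hρ
    gcongr
  refine ⟨M, ?_, fun z hz => by simpa using hMT z hz 1, ?_⟩
  -- Holomorphy spreads the same way: near z, M equals T_m M, which only involves M near F_m z.
  · intro z hz
    obtain ⟨m, hm⟩ := ((hconv z hz).eventually (Metric.ball_mem_nhds z₀ hr)).exists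
    have hzD := Metric.isOpen_ball.mem_nhds hz
    have hFd := (H.semigroup.holomorphic m m.cast_nonneg).differentiableAt hzD
    have h1 : DifferentiableAt ℂ (transfer F Γ B m M) z :=
      ((differentiableAt_const _).mul
        ((hMU.differentiableAt (Metric.isOpen_ball.mem_nhds hm)).comp z hFd)).mul
        ((H.cocycle.holomorphic m m.cast_nonneg).differentiableAt hzD)
    refine (h1.congr_of_eventuallyEq ?_).differentiableWithinAt
    filter_upwards [hzD] with w hw using (hMT w hw m).symm
  · refine IsBigO.of_bound (C / (1 - ρ)) ?_
    filter_upwards [Metric.ball_mem_nhds z₀ hr] with z hz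
    have := dist_le_of_le_geometric_of_tendsto₀ ρ _ hρ (hdist z hz) (hM z (hsub hz))
    rw [dist_comm, dist_eq_norm] at this
    rw [norm_pow, div_mul_eq_mul_div]
    exact this

/-- Fixed points of the time-one transfer operator vanishing to high order are zero. -/
theorem eq_zero_of_fixed (H : IsCocycleAtFixedPoint F Γ z₀ lam B)
    (hconv : ∀ z ∈ 𝔻, Tendsto (fun n : ℕ => F n z) atTop (𝓝 z₀)) {q κ : ℝ} (hq0 : 0 ≤ q)
    (hq1 : q ≤ 1) (hq : ∀ᶠ z in 𝓝 z₀, ‖F 1 z - z₀‖ ≤ q * ‖z - z₀‖)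
    (hκ : ∀ᶠ z in 𝓝 z₀, ‖Γ 1 z‖ ≤ κ) {n : ℕ}
    (hρ : ‖NormedSpace.exp ((-((1 : ℝ) : ℂ)) • B)‖ * κ * q ^ n < 1) {D : ℂ → A}
    (hD : ∀ z ∈ 𝔻, transfer F Γ B 1 D z = D z)
    (hO : D =O[𝓝 z₀] fun z => (z - z₀) ^ n) {z : ℂ} (hz : z ∈ 𝔻) : D z = 0 := by
  obtain ⟨r, hr, C, hC0, hsub, hbound⟩ := H.exists_iterate_bound hq0 hq1 hq hκ hO
  have hρ0 : 0 ≤ ‖NormedSpace.exp ((-((1 : ℝ) : ℂ)) • B)‖ * κ * q ^ n := by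
    obtain ⟨z, hz⟩ := hκ.exists
    have : 0 ≤ κ := (norm_nonneg _).trans hz
    positivity
  have hfix : ∀ j : ℕ, ∀ w ∈ 𝔻, (transfer F Γ B 1)^[j] D w = D w := by
    intro j
    induction j with
    | zero => exact fun w _ => rfl
    | succ j ih =>
      intro w hw
      rw [Function.iterate_succ_apply', transfer, ih _ (H.semigroup.mapsTo 1 zero_le_one hw)]
      exact hD w hw
  have hU : ∀ w ∈ Metric.ball z₀ r, D w = 0 := by
    intro w hw
    have h0 := (tendsto_pow_atTop_nhds_zero_of_lt_one hρ0 hρ).const_mul (C * ‖w - z₀‖ ^ n)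
    rw [mul_zero] at h0
    refine norm_le_zero_iff.1 (ge_of_tendsto h0 (Eventually.of_forall fun j => ?_))
    rw [← hfix j w (hsub hw)]
    exact hbound j w hw
  obtain ⟨m, hm⟩ := ((hconv z hz).eventually (Metric.ball_mem_nhds z₀ hr)).exists
  rw [← hfix m z hz, H.iterate_transfer_one _ m hz, transfer, hU _ hm, mul_zero, zero_mul]

theorem exists_linearization (H : IsCocycleAtFixedPoint F Γ z₀ lam B) (hre : 0 < lam.re)
    (hspec : ∀ k : ℕ, 1 ≤ k → lam * k ∉ spectrum ℂ (adOp B)) :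
    ∃ M : ℂ → A, IsLinearization F Γ B M := by
  have hd1 := H.hasDerivAt 1 zero_le_one
  set a := Complex.exp (-lam * (1 : ℝ)) with ha
  have ha1 : ‖a‖ < 1 := by
    rw [ha, Complex.norm_exp]
    simpa using hre
  have hconv : ∀ z ∈ 𝔻, Tendsto (fun n : ℕ => F n z) atTop (𝓝 z₀) := by
    intro z hz
    simp only [H.semigroup.natCast_eq_iterate hz]
    exact tendsto_iterate_of_norm_deriv_lt_one (H.semigroup.holomorphic 1 zero_le_one)
      (H.semigroup.mapsTo 1 zero_le_one) H.mem (H.fixed 1 zero_le_one) hd1 ha1 hz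
  obtain ⟨q, haq, hq1⟩ := exists_between ha1
  have hq0 : 0 ≤ q := (norm_nonneg a).trans haq.le
  have hq : ∀ᶠ z in 𝓝 z₀, ‖F 1 z - z₀‖ ≤ q * ‖z - z₀‖ := by
    filter_upwards [(hasDerivAt_iff_isLittleO.1 hd1).bound (sub_pos.2 haq)] with z hz
    rw [H.fixed 1 zero_le_one] at hz
    calc ‖F 1 z - z₀‖ = ‖(F 1 z - z₀ - (z - z₀) • a) + (z - z₀) • a‖ := by rw [sub_add_cancel]
      _ ≤ (q - ‖a‖) * ‖z - z₀‖ + ‖z - z₀‖ * ‖a‖ :=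
        (norm_add_le _ _).trans (add_le_add hz (norm_smul_le _ _))
      _ = q * ‖z - z₀‖ := by ring
  obtain ⟨κ, hκ⟩ : ∃ κ, ∀ᶠ z in 𝓝 z₀, ‖Γ 1 z‖ ≤ κ :=
    ⟨‖Γ 1 z₀‖ + 1, ((H.differentiableAt_cocycle zero_le_one).continuousAt.norm.eventually_le_const
      (lt_add_one _))⟩
  obtain ⟨N, hN⟩ : ∃ N : ℕ,
      ‖NormedSpace.exp ((-((1 : ℝ) : ℂ)) • B)‖ * κ * q ^ (N + 1) < 1 := by
    have h0 := ((tendsto_add_atTop_iff_nat 1).2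
      (tendsto_pow_atTop_nhds_zero_of_lt_one hq0 hq1)).const_mul
      (‖NormedSpace.exp ((-((1 : ℝ) : ℂ)) • B)‖ * κ)
    rw [mul_zero] at h0
    exact (h0.eventually_lt_const one_pos).exists
  -- Only finitely many orders matter, so one small τ serves them all. Time one itself may fail, as
  -- e^{ad_B - λk} - 1 can be singular through a nonzero multiple of 2πi; taking τ = 1/(m + 1) makes
  -- time one a multiple of τ.
  obtain ⟨m, hm⟩ : ∃ m : ℕ, ∀ k ∈ Finset.Icc 1 N,
      IsUnit (homologicalOp B (lam * (k : ℕ)) ((1 / ((m : ℝ) + 1) : ℝ) : ℂ)) := by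
    have h1 : ∀ᶠ τ in 𝓝[≠] (0 : ℂ), ∀ k ∈ Finset.Icc 1 N,
        IsUnit (homologicalOp B (lam * (k : ℕ)) τ) :=
      (Finset.eventually_all _).2 fun k hk =>
        eventually_isUnit_homologicalOp (hspec k (Finset.mem_Icc.1 hk).1)
    have h2 : Tendsto (fun m : ℕ => ((1 / ((m : ℝ) + 1) : ℝ) : ℂ)) atTop (𝓝[≠] 0) := by
      refine tendsto_nhdsWithin_iff.2 ⟨?_, Eventually.of_forall fun m => ?_⟩
      · exact (Complex.continuous_ofReal.tendsto' 0 0 Complex.ofReal_zero).comp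
          tendsto_one_div_add_atTop_nhds_zero_nat
      · have : (1 / ((m : ℝ) + 1)) ≠ 0 := by positivity
        simpa only [mem_compl_iff, mem_singleton_iff, Complex.ofReal_eq_zero] using this
    exact (h2.eventually h1).exists
  set τ : ℝ := 1 / ((m : ℝ) + 1) with hτdef
  have hτ : 0 ≤ τ := by positivity
  obtain ⟨P, hP, hP1, hPO⟩ := H.exists_approx hτ N hm
  have hPO1 : (transfer F Γ B 1 P - P) =O[𝓝 z₀] fun z => (z - z₀) ^ (N + 1) := by
    have h := H.transfer_nat_mul_sub_isBigO hτ hPO (m + 1)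
    have e : ((m + 1 : ℕ) : ℝ) * τ = 1 := by
      rw [hτdef]; push_cast; field_simp
    rwa [e] at h
  obtain ⟨M, hMd, hMfix, hMP⟩ :=
    H.exists_fixed_of_approx hconv hq0 hq1.le hq hκ hN hP hPO1
  have hM1 : M z₀ = 1 := by
    obtain ⟨C, hC⟩ := hMP.bound
    have h := hC.self_of_nhds
    rw [sub_self, zero_pow N.succ_ne_zero, norm_zero, mul_zero, norm_le_zero_iff, Pi.sub_apply,
      sub_eq_zero] at h
    rw [h, hP1]
  have hMτ : (transfer F Γ B τ M - M) =O[𝓝 z₀] fun z => (z - z₀) ^ (N + 1) := by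
    refine ((hPO.add (H.transfer_isBigO hτ hMP)).sub hMP).congr_left fun z => ?_
    rw [transfer_sub]
    simp only [Pi.sub_apply]
    abel
  have hinv : ∀ s, 0 ≤ s → ∀ z ∈ 𝔻, transfer F Γ B s M z = M z := by
    intro s hs z hz
    have hDd : DifferentiableOn ℂ (transfer F Γ B s M - M) 𝔻 :=
      (H.differentiableOn_transfer hs hMd).sub hMd
    have hDτ : (transfer F Γ B τ (transfer F Γ B s M - M) - (transfer F Γ B s M - M))
        =O[𝓝 z₀] fun z => (z - z₀) ^ (N + 1) := by
      refine ((H.transfer_isBigO hs hMτ).sub hMτ).congr' ?_ EventuallyEq.rfl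
      filter_upwards [H.mem_nhds] with w hw
      simp only [Pi.sub_apply, transfer_sub]
      rw [H.transfer_comm hs hτ M hw]
      abel
    -- Vanishing at z₀ starts the climb; each invertible homological operator kills the next leading
    -- coefficient, up to the order N + 1 needed for uniqueness.
    have hDO : ∀ k ≤ N, (transfer F Γ B s M - M) =O[𝓝 z₀] fun z => (z - z₀) ^ (k + 1) := by
      intro k
      induction k with
      | zero =>
        intro _
        refine H.isBigO_pow_one_of_apply_eq_zero hDd ?_
        rw [Pi.sub_apply, H.transfer_apply_fixed hs hM1, hM1, sub_self]
      | succ k ih =>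
        intro hk
        exact H.isBigO_succ_of_transfer_sub hτ (hm (k + 1) (by simp [hk])) hDd
          (ih (Nat.le_of_succ_le hk)) (hDτ.trans (pow_isBigO_pow_of_le z₀ (by lia)))
    refine sub_eq_zero.1 (H.eq_zero_of_fixed hconv hq0 hq1.le hq hκ hN
      (D := transfer F Γ B s M - M) ?_ (hDO N le_rfl) hz)
    intro w hw
    rw [transfer_sub, Pi.sub_apply, H.transfer_comm zero_le_one hs M hw, hMfix w hw]
    congr 1
    rw [transfer, hMfix _ (H.semigroup.mapsTo s hs hw), transfer]
  have hunit : ∀ z ∈ 𝔻, IsUnit (M z) := by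
    intro z hz
    have hnear : ∀ᶠ w in 𝓝 z₀, IsUnit (M w) := by
      refine (hMd.differentiableAt H.mem_nhds).continuousAt.eventually ?_
      rw [hM1]
      exact Units.isOpen.mem_nhds isUnit_one
    obtain ⟨j, hj⟩ := ((hconv z hz).eventually hnear).exists
    rw [← hinv j j.cast_nonneg z hz, transfer]
    exact ((isUnit_exp_smul _ B).mul hj).mul (H.cocycle.isUnit H.semigroup hz j.cast_nonneg)
  refine ⟨M, hMd, hunit, fun t ht z hz => ?_⟩
  rw [← hinv t ht z hz, transfer, mul_assoc, mul_assoc, ← mul_assoc (NormedSpace.exp _),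
    exp_smul_mul_exp_neg_smul, one_mul,
    Ring.inverse_mul_cancel_left _ _ (hunit _ (H.semigroup.mapsTo t ht hz))]

end IsCocycleAtFixedPoint

theorem theorem3p9 {A : Type*} [NormedRing A] [NormedAlgebra ℂ A] [CompleteSpace A]
    [NormOneClass A]
    (F : ℝ → ℂ → ℂ) (hF : IsHolSemigroup F)
    (f : ℂ → ℂ) (hf : IsHolGenerator F f)
    (z₀ : ℂ) (hz₀ : z₀ ∈ Metric.ball (0 : ℂ) 1) (hfz₀ : f z₀ = 0)
    (lam : ℂ) (hlam : lam = -deriv f z₀) (hre : 0 < lam.re)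
    (Γ : ℝ → ℂ → A) (hΓ : IsHolSemicocycle F Γ)
    (B₀ : A) (hB₀ : B₀ = semicocycleGenerator Γ z₀) :
    DifferentiableWithinAt ℝ (fun t : ℝ => Γ t z₀) (Set.Ici 0) 0 ∧
      (spectrum ℂ (adOp B₀) ∩ {μ : ℂ | ∃ k : ℕ, 1 ≤ k ∧ μ = lam * (k : ℂ)} = ∅ →
        ∃ M : ℂ → A, IsLinearization F Γ B₀ M) := by
  have hfix : ∀ t, 0 ≤ t → F t z₀ = z₀ := fun t ht => hf.apply_eq_self hF hz₀ hfz₀ ht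
  have hc : ContinuousOn (fun t : ℝ => Γ t z₀) (Ici 0) :=
    hΓ.continuousOn.comp (f := fun t : ℝ => (t, z₀)) (by fun_prop) fun t ht => ⟨ht, hz₀⟩
  -- At the fixed point the chain rule becomes a semigroup law in `A`, so continuity alone gives
  -- differentiability and the exponential form.
  have hadd : ∀ s t, 0 ≤ s → 0 ≤ t → Γ (s + t) z₀ = Γ s z₀ * Γ t z₀ := fun s t hs ht => by
    rw [← hΓ.chain s t hs ht z₀ hz₀, hfix t ht]
  have hd : DifferentiableWithinAt ℝ (fun t : ℝ => Γ t z₀) (Ici 0) 0 := by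
    obtain ⟨B, hB⟩ := exists_hasDerivWithinAt_of_semigroup hc (hΓ.zero z₀ hz₀) hadd
    exact hB.differentiableWithinAt
  refine ⟨hd, fun hspec => ?_⟩
  have hB : HasDerivWithinAt (fun t : ℝ => Γ t z₀) B₀ (Ici 0) 0 := by
    rw [hB₀]; exact hd.hasDerivWithinAt
  have H : IsCocycleAtFixedPoint F Γ z₀ lam B₀ :=
    { semigroup := hF
      cocycle := hΓ
      mem := hz₀
      fixed := hfix
      hasDerivAt := fun t ht => by
        rw [hlam, neg_neg]; exact hf.hasDerivAt_flow hF hz₀ hfz₀ ht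
      value := fun t ht => semigroup_eq_exp hc (hΓ.zero z₀ hz₀) hadd hB ht }
  refine H.exists_linearization hre fun k hk hmem => ?_
  exact eq_empty_iff_forall_notMem.1 hspec _ ⟨hmem, k, hk, rfl⟩
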